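/- Fix real constants $\theta,\lambda>0$. There is a constant $C=C(\theta,\lambda)$ such that the following holds for every positive integer $q$ and every primitive quadratic (that is, real-valued and non-principal) Dirichlet character $\chi$ modulo $q$ for which $L(s,\chi)$ satisfies the Generalized Riemann Hypothesis (every zero of $L(s,\chi)$ with $0<\Re s<1$ has $\Re s=\tfrac12$). Put $N=q^{\theta}$ and $\sigma=1+\frac{\lambda}{\log q}$. Then $$\Bigl|\sum_{\substack{p\le N\\ p\text{ prime}}}\left(\frac{\log p}{p^{\sigma}-1}+\frac{\chi(p)\log p}{p^{\sigma}-\chi(p)}\right)-\frac{1-e^{-\lambda\theta}}{\lambda}\log q\Bigr|\le C\log\log q .$$ (Such characters exist only for $q\ge 3$, so $\log\log q>0$.) -/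

import Mathlib

/-- The Generalized Riemann Hypothesis for the single Dirichlet `L`-function `L(s, χ)`: every zero
of (the analytic continuation of) `L(s, χ)` in the critical strip `0 < Re s < 1` lies on the line
`Re s = 1/2`. -/
def GRHFor {q : ℕ} [NeZero q] (χ : DirichletCharacter ℂ q) : Prop :=
  ∀ s : ℂ, 0 < s.re → s.re < 1 → χ.LFunction s = 0 → s.re = 1 / 2

/-- The sum over primes `p ≤ N` of
`log p / (p ^ σ - 1) + χ(p) * log p / (p ^ σ - χ(p))`, for real `N` and `σ`. -/
noncomputable def primeSum {q : ℕ} (χ : DirichletCharacter ℂ q) (N σ : ℝ) : ℂ :=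
  ∑ p ∈ Finset.Icc 1 ⌊N⌋₊ with p.Prime,
    ((Real.log p : ℂ) / (((p : ℝ) ^ σ : ℝ) - 1)
      + χ (p : ZMod q) * (Real.log p : ℂ) / (((p : ℝ) ^ σ : ℝ) - χ (p : ZMod q)))

/-!
The trivial character contributes the main term and `χ` contributes only `O(log log q)`.

Write `σ = 1 + δ` with `δ = λ / log q`. Prime powers cost `O(1)` (`exists_norm_primeSum_sub_le`),
so the sum may be replaced by `∑ Λ(n) n^(-σ) + ∑ χ(n) Λ(n) n^(-σ)` over `n ≤ N`.
Mertens' first theorem and partial summation give `(1 - N^(-δ)) / δ + O(1)` for the first sum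
(`exists_abs_sum_vonMangoldt_div_mul_rpow_sub_le`), and `N^(-δ) = e^(-λθ)`.

For the second sum, Mertens' theorem bounds the part `n ≤ y = (log q)^4` by `4 log log q + O(1)`,
and GRH makes the rest `O(1)` as follows. Replacing the sharp cut-off at `x` by the weight `1 - n/x`
changes the sum by at most `ψ(x)/x = O(1)`. With this weight Perron's formula has the absolutely
convergent kernel `x^s / (s (s + 1))` (`rieszMean_eq_integral`). In the difference of the means at
`N` and at `y` the pole at `s = 0` disappears, and the line of integration moves to `Re s = -1/4`
(`norm_integral_mul_cpow_sub_cpow_le`), where the kernel is `O(y^(-1/4)) = O(1 / log q)`. It remains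
to see that `L'/L` at `s + σ` is `O(log q)`, up to a factor `(1 + (Im s)^2)^(1/4)`: under GRH `L`
has a logarithm on discs in `Re s > 1/2`, its real part is bounded above since
`|L(s, χ)| ≤ q |s| / Re s`, and Borel–Carathéodory with Cauchy's estimate bounds the derivative
(`exists_norm_deriv_LFunction_div_le_of_GRHFor`).
-/

/-! ### Mertens' first theorem -/

open ArithmeticFunction in
theorem sum_vonMangoldt_mul_div_eq_log_factorial (n : ℕ) :
    ∑ d ∈ Finset.Ioc 0 n, vonMangoldt d * ((n / d : ℕ) : ℝ) = Real.log (n.factorial : ℝ) := by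
  rw [← sum_Ioc_mul_zeta_eq_sum, vonMangoldt_mul_zeta]
  induction n with
  | zero => simp
  | succ n ih =>
    rw [Finset.sum_Ioc_succ_top (Nat.zero_le n), ih, Nat.factorial_succ, Nat.cast_mul,
      Real.log_mul (by positivity) (by positivity), log_apply, add_comm]

theorem mul_log_sub_le_log_factorial (n : ℕ) :
    n * Real.log n - n ≤ Real.log (n.factorial : ℝ) := by
  rcases n.eq_zero_or_pos with rfl | hn
  · simp
  have hn' : (0 : ℝ) < n := by exact_mod_cast hn
  have h := Real.log_le_log (by positivity) (Real.pow_div_factorial_le_exp (n : ℝ) hn'.le n)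
  rw [Real.log_exp, Real.log_div (by positivity) (by positivity), Real.log_pow] at h
  linarith

theorem log_factorial_le_mul_log (n : ℕ) : Real.log (n.factorial : ℝ) ≤ n * Real.log n := by
  rw [← Real.log_pow]
  exact Real.log_le_log (by positivity) (by exact_mod_cast Nat.factorial_le_pow n)

open ArithmeticFunction in
/-- **Mertens' first theorem** for the von Mangoldt function. -/
theorem exists_abs_sum_vonMangoldt_div_sub_log_le :
    ∃ C : ℝ, ∀ x : ℝ, 1 ≤ x →
      |∑ n ∈ Finset.Icc 1 ⌊x⌋₊, vonMangoldt n / n - Real.log x| ≤ C := by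
  refine ⟨Real.log 4 + 6, fun x hx => ?_⟩
  set n := ⌊x⌋₊ with hn
  have hn1 : 1 ≤ n := Nat.one_le_floor_iff x |>.mpr hx
  have hn' : (0 : ℝ) < n := by exact_mod_cast hn1
  have hle : (n : ℝ) ≤ x := Nat.floor_le (by linarith)
  have hlt : x < n + 1 := Nat.lt_floor_add_one x
  have hlog1 : Real.log n ≤ Real.log x := Real.log_le_log hn' hle
  have hlog2 : Real.log x ≤ Real.log n + 1 := by
    have h2 : x ≤ n * 2 := by
      have : (1 : ℝ) ≤ n := by exact_mod_cast hn1
      linarith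
    have := Real.log_le_log (by linarith) h2
    rw [Real.log_mul hn'.ne' two_ne_zero] at this
    have := Real.log_two_lt_d9
    linarith
  have hI : Finset.Icc 1 n = Finset.Ioc 0 n := by ext; simp [Nat.succ_le_iff]
  rw [hI]
  set M := ∑ d ∈ Finset.Ioc 0 n, vonMangoldt d / d with hM
  have hup : Real.log (n.factorial : ℝ) ≤ n * M := by
    rw [← sum_vonMangoldt_mul_div_eq_log_factorial, hM, Finset.mul_sum]
    refine Finset.sum_le_sum fun d _ => ?_
    calc vonMangoldt d * ((n / d : ℕ) : ℝ) ≤ vonMangoldt d * ((n : ℝ) / d) :=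
          mul_le_mul_of_nonneg_left Nat.cast_div_le vonMangoldt_nonneg
      _ = n * (vonMangoldt d / d) := by ring
  have hlow : n * M - Chebyshev.psi n ≤ Real.log (n.factorial : ℝ) := by
    rw [← sum_vonMangoldt_mul_div_eq_log_factorial, hM, Finset.mul_sum, Chebyshev.psi,
      Nat.floor_natCast, ← Finset.sum_sub_distrib]
    refine Finset.sum_le_sum fun d hd => ?_
    have hd0 : 0 < d := (Finset.mem_Ioc.mp hd).1
    have h1 : (n : ℝ) / d ≤ ((n / d : ℕ) : ℝ) + 1 := by
      rw [div_le_iff₀ (by exact_mod_cast hd0)]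
      have := (Nat.lt_div_mul_add hd0 (a := n)).le
      have h2 : n ≤ (n / d + 1) * d := by rw [add_mul, one_mul]; exact this
      exact_mod_cast h2
    have h2 := mul_le_mul_of_nonneg_left h1 (vonMangoldt_nonneg (n := d))
    calc (n : ℝ) * (vonMangoldt d / d) - vonMangoldt d
        = vonMangoldt d * ((n : ℝ) / d) - vonMangoldt d := by ring
      _ ≤ _ := by linarith
  have h1 := mul_log_sub_le_log_factorial n
  have h2 := log_factorial_le_mul_log n
  have h3 := Chebyshev.psi_le_const_mul_self hn'.le
  have hA : Real.log n - 1 ≤ M := by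
    refine le_of_mul_le_mul_left ?_ hn'
    linarith
  have hB : M ≤ Real.log n + (Real.log 4 + 4) := by
    refine le_of_mul_le_mul_left ?_ hn'
    linarith
  have : 0 ≤ Real.log 4 := Real.log_nonneg (by norm_num)
  rw [abs_le]
  constructor <;> linarith

open ArithmeticFunction in
/-- Partial summation from Mertens' first theorem, uniform in the exponent. -/
theorem exists_abs_sum_vonMangoldt_div_mul_rpow_sub_le :
    ∃ C : ℝ, ∀ δ : ℝ, 0 < δ → ∀ x : ℝ, 1 ≤ x →
      |∑ n ∈ Finset.Icc 1 ⌊x⌋₊, vonMangoldt n / n * (n : ℝ) ^ (-δ) - (1 - x ^ (-δ)) / δ| ≤ C := by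
  obtain ⟨C, hC⟩ := exists_abs_sum_vonMangoldt_div_sub_log_le
  refine ⟨C, fun δ hδ x hx => ?_⟩
  have hx0 : 0 < x := by linarith
  have hset (n : ℕ) : Finset.Ioc 0 n = Finset.Icc 1 n := by ext; simp [Nat.succ_le_iff]
  have h01 (n : ℕ) : ∑ k ∈ Finset.Icc 0 n, vonMangoldt k / k
      = ∑ k ∈ Finset.Icc 1 n, vonMangoldt k / k := by
    rw [← Finset.add_sum_Ioc_eq_sum_Icc (Nat.zero_le n), hset]
    simp
  have hderiv (t : ℝ) (ht : 0 < t) : HasDerivAt (fun t : ℝ => t ^ (-δ)) (-δ * t ^ (-δ - 1)) t :=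
    Real.hasDerivAt_rpow_const (Or.inl ht.ne')
  have hcont : ContinuousOn (fun t : ℝ => -δ * t ^ (-δ - 1)) (Set.Icc 1 x) :=
    continuousOn_const.mul (continuousOn_id.rpow_const fun t ht => Or.inl (by
      have := ht.1; simp only [id]; linarith))
  have hd : Set.EqOn (deriv fun t : ℝ => t ^ (-δ)) (fun t : ℝ => -δ * t ^ (-δ - 1)) (Set.Icc 1 x) :=
    fun t ht => (hderiv t (by linarith [ht.1])).deriv
  have hint' : MeasureTheory.IntegrableOn (fun t : ℝ => -δ * t ^ (-δ - 1)) (Set.Icc 1 x) :=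
    hcont.integrableOn_compact isCompact_Icc
  have hint : MeasureTheory.IntegrableOn (deriv fun t : ℝ => t ^ (-δ)) (Set.Icc 1 x) :=
    hint'.congr_fun hd.symm measurableSet_Icc
  have habel := sum_mul_eq_sub_integral_mul₀ (f := fun t : ℝ => t ^ (-δ))
    (fun n : ℕ => vonMangoldt n / n) (by simp) x
    (fun t ht => (hderiv t (by linarith [ht.1])).differentiableAt) hint
  simp only [h01] at habel
  have hIcc : ∑ k ∈ Finset.Icc 0 ⌊x⌋₊, (k : ℝ) ^ (-δ) * (vonMangoldt k / k)
      = ∑ n ∈ Finset.Icc 1 ⌊x⌋₊, vonMangoldt n / n * (n : ℝ) ^ (-δ) := by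
    rw [← Finset.add_sum_Ioc_eq_sum_Icc (Nat.zero_le _), hset]
    simp [mul_comm]
  rw [hIcc] at habel
  rw [habel]
  set M : ℝ → ℝ := fun t => ∑ k ∈ Finset.Icc 1 ⌊t⌋₊, vonMangoldt k / k with hM
  have hMint : MeasureTheory.IntegrableOn
      (fun t => deriv (fun t : ℝ => t ^ (-δ)) t * M t) (Set.Ioc 1 x) :=
    (integrableOn_mul_sum_Icc _ zero_le_one hint).mono_set Set.Ioc_subset_Icc_self
  -- the same identity with `log` in place of the partial sums, from an explicit primitive
  have hprim (t : ℝ) (ht : 0 < t) :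
      HasDerivAt (fun t : ℝ => t ^ (-δ) * Real.log t + t ^ (-δ) / δ)
        (-δ * t ^ (-δ - 1) * Real.log t) t := by
    have h := ((hderiv t ht).mul (Real.hasDerivAt_log ht.ne')).add ((hderiv t ht).div_const δ)
    refine h.congr_deriv ?_
    rw [Real.rpow_sub_one ht.ne']
    field_simp
    ring
  have hlogcont : ContinuousOn (fun t : ℝ => -δ * t ^ (-δ - 1) * Real.log t) (Set.Icc 1 x) :=
    hcont.mul (Real.continuousOn_log.mono fun t ht => by
      have := ht.1; simp only [Set.mem_compl_iff, Set.mem_singleton_iff]; linarith)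
  have hlogint : MeasureTheory.IntegrableOn (fun t : ℝ => -δ * t ^ (-δ - 1) * Real.log t)
      (Set.Ioc 1 x) :=
    (hlogcont.integrableOn_compact isCompact_Icc).mono_set Set.Ioc_subset_Icc_self
  have hlog : ∫ t in Set.Ioc 1 x, -δ * t ^ (-δ - 1) * Real.log t
      = x ^ (-δ) * Real.log x + x ^ (-δ) / δ - 1 / δ := by
    rw [← intervalIntegral.integral_of_le hx,
      intervalIntegral.integral_eq_sub_of_hasDerivAt (f := fun t : ℝ =>
        t ^ (-δ) * Real.log t + t ^ (-δ) / δ)]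
    · simp
    · intro t ht
      rw [Set.uIcc_of_le hx] at ht
      exact hprim t (by linarith [ht.1])
    · exact (intervalIntegrable_iff_integrableOn_Ioc_of_le hx).mpr hlogint
  have hone : ∫ t in Set.Ioc 1 x, -δ * t ^ (-δ - 1) = x ^ (-δ) - 1 := by
    rw [← intervalIntegral.integral_of_le hx,
      intervalIntegral.integral_eq_sub_of_hasDerivAt (f := fun t : ℝ => t ^ (-δ))]
    · simp
    · intro t ht
      rw [Set.uIcc_of_le hx] at ht
      exact hderiv t (by linarith [ht.1])
    · exact (intervalIntegrable_iff_integrableOn_Ioc_of_le hx).mpr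
        (hint'.mono_set Set.Ioc_subset_Icc_self)
  have hdiff : |(∫ t in Set.Ioc 1 x, deriv (fun t : ℝ => t ^ (-δ)) t * M t)
      - ∫ t in Set.Ioc 1 x, -δ * t ^ (-δ - 1) * Real.log t| ≤ C * (1 - x ^ (-δ)) := by
    rw [← MeasureTheory.integral_sub hMint hlogint]
    have hg : MeasureTheory.IntegrableOn (fun t : ℝ => -C * (-δ * t ^ (-δ - 1))) (Set.Ioc 1 x) :=
      (hint'.mono_set Set.Ioc_subset_Icc_self).const_mul _
    have := MeasureTheory.norm_integral_le_of_norm_le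
      (f := fun t : ℝ => deriv (fun t : ℝ => t ^ (-δ)) t * M t - -δ * t ^ (-δ - 1) * Real.log t)
      hg (by
      refine (MeasureTheory.ae_restrict_iff' measurableSet_Ioc).mpr (.of_forall fun t ht => ?_)
      rw [hd ⟨ht.1.le, ht.2⟩, ← mul_sub, norm_mul, Real.norm_eq_abs, Real.norm_eq_abs, abs_mul,
        abs_neg, abs_of_pos hδ, abs_of_nonneg (Real.rpow_nonneg (by linarith [ht.1]) _)]
      calc δ * t ^ (-δ - 1) * |M t - Real.log t| ≤ δ * t ^ (-δ - 1) * C :=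
            mul_le_mul_of_nonneg_left (hC t ht.1.le)
              (mul_nonneg hδ.le (Real.rpow_nonneg (by linarith [ht.1]) _))
        _ = _ := by ring)
    rw [MeasureTheory.integral_const_mul, hone, Real.norm_eq_abs] at this
    linarith
  have hmain : |x ^ (-δ) * (M x - Real.log x)| ≤ C * x ^ (-δ) := by
    rw [abs_mul, abs_of_nonneg (Real.rpow_nonneg hx0.le _), mul_comm]
    exact mul_le_mul_of_nonneg_right (hC x hx) (Real.rpow_nonneg hx0.le _)
  rw [hlog] at hdiff
  have e : x ^ (-δ) * M x - (∫ t in Set.Ioc 1 x, deriv (fun t : ℝ => t ^ (-δ)) t * M t)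
      - (1 - x ^ (-δ)) / δ = x ^ (-δ) * (M x - Real.log x)
      - ((∫ t in Set.Ioc 1 x, deriv (fun t : ℝ => t ^ (-δ)) t * M t)
        - (x ^ (-δ) * Real.log x + x ^ (-δ) / δ - 1 / δ)) := by
    ring
  rw [show x ^ (-δ) * ∑ k ∈ Finset.Icc 1 ⌊x⌋₊, vonMangoldt k / k = x ^ (-δ) * M x from rfl, e]
  exact (abs_sub _ _).trans (by linarith)

open ArithmeticFunction in
theorem exists_sum_vonMangoldt_div_not_prime_le :
    ∃ C : ℝ, ∀ s : Finset ℕ, ∑ n ∈ s with ¬ n.Prime, vonMangoldt n / n ≤ C := by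
  have h := vonMangoldt.summable_residueClass_non_primes_div (q := 1) 0
  refine ⟨_, fun s => le_trans (le_of_eq ?_) (h.sum_le_tsum s fun n _ => ?_)⟩
  · rw [Finset.sum_filter]
    refine Finset.sum_congr rfl fun n _ => ?_
    by_cases hn : n.Prime
    · simp [hn]
    · simp [hn, vonMangoldt.residueClass, Set.indicator, Subsingleton.elim (n : ZMod 1) 0]
  · positivity [vonMangoldt.residueClass_nonneg (q := 1) 0 n]

/-! ### Elementary bounds for `L(s, χ)` -/

open Complex in
theorem norm_sum_range_dirichletCharacter_le {q : ℕ} [NeZero q] {χ : DirichletCharacter ℂ q}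
    (hχ : χ ≠ 1) (n : ℕ) : ‖∑ k ∈ Finset.range n, χ k‖ ≤ q := by
  have hq : 0 < q := Nat.pos_of_ne_zero (NeZero.ne q)
  have hper : ∑ k ∈ Finset.range q, χ k = 0 := by
    rw [← MulChar.sum_eq_zero_of_ne_one hχ]
    refine Finset.sum_nbij' (fun k => (k : ZMod q)) ZMod.val (by simp)
      (fun a _ => Finset.mem_range.mpr (ZMod.val_lt a))
      (fun k hk => ZMod.val_cast_of_lt (Finset.mem_range.mp hk)) (by simp) (by simp)
  induction n using Nat.strong_induction_on with
  | _ n ih =>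
    rcases lt_or_ge n q with h | h
    · calc ‖∑ k ∈ Finset.range n, χ k‖ ≤ ∑ k ∈ Finset.range n, (1 : ℝ) :=
            norm_sum_le_of_le _ fun k _ => χ.norm_le_one _
        _ = n := by simp
        _ ≤ q := by exact_mod_cast h.le
    · obtain ⟨m, rfl⟩ := Nat.exists_eq_add_of_le h
      rw [Finset.sum_range_add, hper, zero_add]
      simpa using ih m (by omega)

theorem norm_sum_Icc_dirichletCharacter_le {q : ℕ} [NeZero q] {χ : DirichletCharacter ℂ q}
    (hχ : χ ≠ 1) (n : ℕ) : ‖∑ k ∈ Finset.Icc 1 n, χ k‖ ≤ q := by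
  have hq : q ≠ 1 := fun h => hχ (DirichletCharacter.level_one' χ h)
  have : ∑ k ∈ Finset.Icc 1 n, χ k = ∑ k ∈ Finset.range (n + 1), χ k := by
    refine Finset.sum_subset (fun k hk => by simp at hk ⊢; omega) fun k hk hk' => ?_
    obtain rfl : k = 0 := by simp at hk hk'; omega
    simp [χ.map_zero' hq]
  rw [this]
  exact norm_sum_range_dirichletCharacter_le hχ _

open Complex MeasureTheory in
/-- Since the partial sums of `χ` are bounded, Abel summation continues `L(s, χ)` to
`0 < Re s`. -/
theorem LFunction_eq_mul_integral {q : ℕ} [NeZero q] {χ : DirichletCharacter ℂ q} (hχ : χ ≠ 1)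
    {s : ℂ} (hs : 0 < s.re) :
    χ.LFunction s =
      s * ∫ t in Set.Ioi (1 : ℝ), (∑ k ∈ Finset.Icc 1 ⌊t⌋₊, χ k) * (t : ℂ) ^ (-(s + 1)) := by
  set A : ℝ → ℂ := fun t => ∑ k ∈ Finset.Icc 1 ⌊t⌋₊, χ k with hA
  have hAm : Measurable A :=
    (measurable_from_nat (f := fun n : ℕ => ∑ k ∈ Finset.Icc 1 n, χ k)).comp Nat.measurable_floor
  have hAb (t : ℝ) : ‖A t‖ ≤ q := norm_sum_Icc_dirichletCharacter_le hχ _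
  -- the integral is a Mellin transform at `-s`, hence holomorphic, and for `1 < Re s` the right
  -- side is `L(s, χ)`
  set g : ℝ → ℂ := (Set.Ioi 1).indicator A with hg
  have hgm : Measurable g := hAm.indicator measurableSet_Ioi
  have hgb (t : ℝ) : ‖g t‖ ≤ q := (norm_indicator_le_norm_self _ _).trans (hAb t)
  have hmel (s : ℂ) : mellin g (-s) = ∫ t in Set.Ioi (1 : ℝ), A t * (t : ℂ) ^ (-(s + 1)) := by
    rw [mellin, ← integral_indicator measurableSet_Ioi, ← integral_indicator measurableSet_Ioi]
    congr 1
    ext t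
    by_cases ht : 1 < t
    · have ht0 : 0 < t := by linarith
      simp only [hg, Set.indicator, Set.mem_Ioi, ht, ht0, if_true, smul_eq_mul]
      rw [mul_comm, neg_add']
    · by_cases ht0 : 0 < t <;> simp [hg, Set.indicator, ht]
  have hdiff : DifferentiableOn ℂ (fun s => s * mellin g (-s)) {s : ℂ | 0 < s.re} := by
    intro s hs
    have hs' : 0 < s.re := hs
    refine DifferentiableAt.differentiableWithinAt (differentiableAt_id.mul ?_)
    have h : DifferentiableAt ℂ (mellin g) (-s) := by
      refine mellin_differentiableAt_of_isBigO_rpow (a := 0) (b := -s.re - 1) ?_ ?_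
        (by simpa using hs') ?_ (by simp)
      · refine LocallyIntegrable.locallyIntegrableOn ?_ _
        exact (locallyIntegrable_const (q : ℝ)).mono hgm.aestronglyMeasurable
          (.of_forall fun t => by simpa using hgb t)
      · refine Asymptotics.IsBigO.of_bound q (.of_forall fun t => ?_)
        simpa using hgb t
      · refine Asymptotics.IsBigO.of_bound 1 ?_
        filter_upwards [Ioo_mem_nhdsGT (zero_lt_one (α := ℝ))] with t ht
        have : ¬ 1 < t := not_lt.mpr ht.2.le
        simp [hg, this]
    exact h.comp s differentiableAt_id.neg
  have hopen : IsOpen {s : ℂ | 0 < s.re} := isOpen_lt continuous_const continuous_re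
  have hconn : IsPreconnected {s : ℂ | 0 < s.re} := (convex_halfSpace_re_gt 0).isPreconnected
  have hev : χ.LFunction =ᶠ[nhds 2] fun s => s * mellin g (-s) := by
    have hopen1 : IsOpen {s : ℂ | 1 < s.re} := isOpen_lt continuous_const continuous_re
    filter_upwards [hopen1.mem_nhds (show (2 : ℂ) ∈ {s : ℂ | 1 < s.re} by simp)] with s hs
    have hs' : 1 < s.re := hs
    rw [χ.LFunction_eq_LSeries hs', hmel]
    refine LSeries_eq_mul_integral _ (r := 0) le_rfl (by linarith)
      (χ.LSeriesSummable_of_one_lt_re hs') ?_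
    refine Asymptotics.IsBigO.of_bound q (.of_forall fun n => ?_)
    simpa using norm_sum_Icc_dirichletCharacter_le hχ n
  have := AnalyticOnNhd.eqOn_of_preconnected_of_eventuallyEq
    ((DirichletCharacter.differentiable_LFunction hχ).differentiableOn.analyticOnNhd hopen)
    (hdiff.analyticOnNhd hopen) hconn (show (2 : ℂ) ∈ {s : ℂ | 0 < s.re} by simp) hev
  rw [← hmel]
  exact this hs

open Complex MeasureTheory in
theorem norm_LFunction_le {q : ℕ} [NeZero q] {χ : DirichletCharacter ℂ q} (hχ : χ ≠ 1)
    {s : ℂ} (hs : 0 < s.re) : ‖χ.LFunction s‖ ≤ ‖s‖ * (q / s.re) := by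
  rw [LFunction_eq_mul_integral hχ hs, norm_mul]
  refine mul_le_mul_of_nonneg_left ?_ (norm_nonneg _)
  have hint : IntegrableOn (fun t : ℝ => (q : ℝ) * t ^ (-(s.re + 1))) (Set.Ioi 1) :=
    (integrableOn_Ioi_rpow_of_lt (by linarith) one_pos).const_mul _
  refine (norm_integral_le_of_norm_le hint ?_).trans (le_of_eq ?_)
  · refine (ae_restrict_iff' measurableSet_Ioi).mpr (.of_forall fun t ht => ?_)
    have ht0 : (0 : ℝ) < t := zero_lt_one.trans ht
    rw [norm_mul, norm_cpow_eq_rpow_re_of_pos ht0]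
    simp only [neg_re, add_re, one_re]
    exact mul_le_mul_of_nonneg_right (norm_sum_Icc_dirichletCharacter_le hχ _)
      (Real.rpow_nonneg ht0.le _)
  · rw [integral_const_mul, integral_Ioi_rpow_of_lt (by linarith) one_pos]
    simp [div_eq_mul_inv]

open Complex in
/-- The reciprocal `∑ μ(n) χ(n) n ^ (-s)` has absolute value at most `ζ(2) ≤ 2`. -/
theorem one_le_two_mul_norm_LFunction {q : ℕ} [NeZero q] (χ : DirichletCharacter ℂ q) {s : ℂ}
    (hs : 2 ≤ s.re) : 1 ≤ 2 * ‖χ.LFunction s‖ := by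
  have hs1 : 1 < s.re := by linarith
  have h := DirichletCharacter.LSeries.mul_mu_eq_one χ hs1
  rw [← χ.LFunction_eq_LSeries hs1] at h
  have hz := hasSum_zeta_two
  have hM :
      ‖LSeries (((χ ·) : ℕ → ℂ) * fun n => ((ArithmeticFunction.moebius n : ℤ) : ℂ)) s‖ ≤ 2 := by
    refine (tsum_of_norm_bounded hz fun n => ?_).trans ?_
    · rw [LSeries.norm_term_eq]
      split_ifs with hn
      · positivity
      have hn1 : (1 : ℝ) ≤ n := by exact_mod_cast Nat.one_le_iff_ne_zero.mpr hn
      have h1 : ‖(((χ ·) : ℕ → ℂ) * fun n => ((ArithmeticFunction.moebius n : ℤ) : ℂ)) n‖ ≤ 1 := by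
        simp only [Pi.mul_apply, norm_mul]
        refine mul_le_one₀ (χ.norm_le_one _) (norm_nonneg _) ?_
        rw [Complex.norm_intCast]
        exact_mod_cast ArithmeticFunction.abs_moebius_le_one
      refine div_le_div₀ zero_le_one h1 (by positivity) ?_
      calc (n : ℝ) ^ 2 = (n : ℝ) ^ (2 : ℝ) := by norm_num
        _ ≤ _ := Real.rpow_le_rpow_of_exponent_le hn1 hs
    · have := Real.pi_lt_d2
      have := Real.pi_pos
      nlinarith
  have := congrArg norm h
  rw [norm_mul, norm_one] at this
  nlinarith [norm_nonneg (χ.LFunction s)]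

open ArithmeticFunction Complex in
theorem exists_norm_deriv_LFunction_div_le_of_two_le_re :
    ∃ C : ℝ, ∀ (q : ℕ) [NeZero q] (χ : DirichletCharacter ℂ q) (s : ℂ), 2 ≤ s.re →
      ‖deriv χ.LFunction s / χ.LFunction s‖ ≤ C := by
  have hsum := (LSeriesSummable_vonMangoldt (s := 2) (by simp)).norm
  refine ⟨∑' n, ‖LSeries.term (fun n => (vonMangoldt n : ℂ)) 2 n‖, fun q _ χ s hs => ?_⟩
  have hs1 : 1 < s.re := by linarith
  have h := DirichletCharacter.LSeries_twist_vonMangoldt_eq χ hs1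
  rw [← χ.deriv_LFunction_eq_deriv_LSeries hs1, ← χ.LFunction_eq_LSeries hs1, neg_div] at h
  rw [← norm_neg, ← h]
  refine tsum_of_norm_bounded hsum.hasSum fun n => ?_
  refine (LSeries.norm_term_le_of_re_le_re _ (s' := s) (s := 2) (by simpa using hs) n).trans ?_
  refine LSeries.norm_term_le _ ?_
  simpa using mul_le_of_le_one_left (norm_nonneg (vonMangoldt n : ℂ)) (χ.norm_le_one n)

/-! ### The logarithmic derivative under GRH -/

open Complex Metric in
/-- A function without zeros on a disc has a logarithm there; Borel–Carathéodory bounds the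
logarithm and Cauchy's estimate bounds its derivative. -/
theorem norm_deriv_div_le_of_norm_le_exp_mul {f : ℂ → ℂ} {c : ℂ} {r R M : ℝ} (hM : 0 < M)
    (hrR : r < R) (hf : DifferentiableOn ℂ f (ball c R)) (hf0 : ∀ z ∈ ball c R, f z ≠ 0)
    (hfM : ∀ z ∈ ball c R, ‖f z‖ ≤ Real.exp M * ‖f c‖) {z : ℂ} (hz : z ∈ closedBall c r) :
    ‖deriv f z / f z‖ ≤ 8 * M * R / (R - r) ^ 2 := by
  have hr : 0 ≤ r := nonneg_of_mem_closedBall hz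
  have hR : 0 < R := by linarith
  have hdf : DifferentiableOn ℂ (fun z => deriv f z / f z) (ball c R) :=
    (hf.deriv isOpen_ball).div hf hf0
  obtain ⟨g, hgc, hg⟩ := hdf.isExactOn_ball.with_val_at c 0
  have hgd : DifferentiableOn ℂ g (ball c R) :=
    fun w hw => (hg w hw).differentiableAt.differentiableWithinAt
  have hcR : c ∈ ball c R := mem_ball_self hR
  have hexp {w : ℂ} (hw : w ∈ ball c R) : f w = f c * exp (g w) := by
    have hd (w : ℂ) (hw : w ∈ ball c R) :
        HasDerivAt (fun w => f w * exp (-g w)) 0 w := by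
      have h1 := (hf.differentiableAt (isOpen_ball.mem_nhds hw)).hasDerivAt
      refine (h1.mul (hg w hw).neg.cexp).congr_deriv ?_
      field_simp [hf0 w hw]
      ring
    have h := isOpen_ball.is_const_of_deriv_eq_zero (convex_ball c R).isPreconnected
      (fun w hw => (hd w hw).differentiableAt.differentiableWithinAt)
      (fun w hw => (hd w hw).deriv) hw hcR
    simp only [hgc, neg_zero, exp_zero, mul_one] at h
    rw [← h, mul_assoc, ← exp_add, neg_add_cancel, exp_zero, mul_one]
  have hre (w : ℂ) (hw : w ∈ ball c R) : (g w).re ≤ M := by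
    have h := hfM w hw
    rw [hexp hw, norm_mul, norm_exp, mul_comm] at h
    exact Real.exp_le_exp.mp (le_of_mul_le_mul_right h (norm_pos_iff.mpr (hf0 c hcR)))
  have hshift (w : ℂ) (hw : w ∈ ball (0 : ℂ) R) : c + w ∈ ball c R := by
    simpa using hw
  have hBC (w : ℂ) (hw : w ∈ ball c R) : ‖g w‖ ≤ 2 * M * ‖w - c‖ / (R - ‖w - c‖) := by
    have h := borelCaratheodory_zero (f := fun w => g (c + w)) (R := R) (z := w - c) hM
      (hgd.comp (differentiableOn_id.const_add c) hshift) (fun w hw => hre _ (hshift w hw)) hR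
      (by simpa [dist_eq_norm] using hw) (by simpa using hgc)
    simpa using h
  rw [← (hg z (closedBall_subset_ball hrR hz)).deriv]
  have hρ : 0 < (R - r) / 2 := by linarith
  have hzc : ‖z - c‖ ≤ r := by simpa [dist_eq_norm] using hz
  have hin (w : ℂ) (hw : w ∈ closedBall z ((R - r) / 2)) : ‖w - c‖ ≤ (R + r) / 2 := by
    have h1 : ‖w - z‖ ≤ (R - r) / 2 := by simpa [dist_eq_norm] using hw
    calc ‖w - c‖ ≤ ‖w - z‖ + ‖z - c‖ := norm_sub_le_norm_sub_add_norm_sub w z c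
      _ ≤ _ := by linarith
  have hinR (w : ℂ) (hw : w ∈ closedBall z ((R - r) / 2)) : w ∈ ball c R := by
    have := hin w hw
    rw [mem_ball, dist_eq_norm]
    linarith
  have hdcl : DiffContOnCl ℂ g (ball z ((R - r) / 2)) :=
    DifferentiableOn.diffContOnCl (hgd.mono fun w hw => hinR w (closure_ball_subset_closedBall hw))
  refine (norm_deriv_le_of_forall_mem_sphere_norm_le hρ hdcl
    (C := 2 * M * R / ((R - r) / 2)) fun w hw => ?_).trans (le_of_eq ?_)
  · have hw' := sphere_subset_closedBall hw
    have h1 := hin w hw'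
    refine (hBC w (hinR w hw')).trans ?_
    refine div_le_div₀ (by positivity) ?_ hρ (by linarith)
    exact mul_le_mul_of_nonneg_left (by linarith) (by positivity)
  · have : R - r ≠ 0 := by linarith
    field_simp
    ring

theorem log_abs_add_four_le (t : ℝ) : Real.log (|t| + 4) ≤ 6 * (1 + t ^ 2) ^ (1 / 4 : ℝ) := by
  have h0 : 0 ≤ |t| + 4 := by positivity
  have h1 : 0 ≤ 1 + t ^ 2 := by positivity
  have h := Real.log_le_rpow_div h0 (ε := 1 / 2) (by norm_num)
  have hle : |t| + 4 ≤ 9 * (1 + t ^ 2) ^ (1 / 2 : ℝ) := by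
    rw [← Real.sqrt_eq_rpow]
    have h2 : |t| ≤ √(1 + t ^ 2) := Real.abs_le_sqrt (by linarith)
    have h3 : 1 ≤ √(1 + t ^ 2) := Real.one_le_sqrt.mpr (by nlinarith)
    linarith
  have h2 : (|t| + 4) ^ (1 / 2 : ℝ) ≤ 3 * (1 + t ^ 2) ^ (1 / 4 : ℝ) := by
    calc (|t| + 4) ^ (1 / 2 : ℝ) ≤ (9 * (1 + t ^ 2) ^ (1 / 2 : ℝ)) ^ (1 / 2 : ℝ) :=
          Real.rpow_le_rpow h0 hle (by norm_num)
      _ = 3 * (1 + t ^ 2) ^ (1 / 4 : ℝ) := by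
          rw [Real.mul_rpow (by norm_num) (by positivity), ← Real.rpow_mul h1]
          congr 1
          · rw [← Real.sqrt_eq_rpow, show (9 : ℝ) = 3 ^ 2 by norm_num]
            exact Real.sqrt_sq (by norm_num)
          · norm_num
  linarith

open Complex in
theorem LFunction_ne_zero_of_GRHFor {q : ℕ} [NeZero q] {χ : DirichletCharacter ℂ q} (hχ : χ ≠ 1)
    (h : GRHFor χ) {s : ℂ} (hs : 1 / 2 < s.re) : χ.LFunction s ≠ 0 := by
  rcases lt_or_ge s.re 1 with h1 | h1
  · intro h0
    have := h s (by linarith) h1 h0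
    linarith
  · exact χ.LFunction_ne_zero_of_one_le_re (.inl hχ) h1

theorem one_le_log_natCast {q : ℕ} (hq : 3 ≤ q) : 1 ≤ Real.log q := by
  rw [Real.le_log_iff_exp_le (by positivity)]
  have : (3 : ℝ) ≤ q := by exact_mod_cast hq
  have := Real.exp_one_lt_d9
  linarith

open Complex Metric in
/-- To the right of `Re s = 1/2` the only loss is a factor `log q`; the factor in `Im s` is a crude
majorant of `log (|Im s| + 4)`. -/
theorem exists_norm_deriv_LFunction_div_le_of_GRHFor :
    ∃ K : ℝ, 0 ≤ K ∧ ∀ (q : ℕ) [NeZero q] (χ : DirichletCharacter ℂ q), 3 ≤ q → χ ≠ 1 → GRHFor χ →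
      ∀ s : ℂ, 3 / 4 ≤ s.re →
        ‖deriv χ.LFunction s / χ.LFunction s‖
          ≤ K * Real.log q * (1 + s.im ^ 2) ^ (1 / 4 : ℝ) := by
  obtain ⟨C, hC⟩ := exists_norm_deriv_LFunction_div_le_of_two_le_re
  refine ⟨max C 2610, le_max_of_le_right (by norm_num), fun q _ χ hq hχ hG s hs => ?_⟩
  have hlog : 1 ≤ Real.log q := one_le_log_natCast hq
  have hone : 1 ≤ (1 + s.im ^ 2) ^ (1 / 4 : ℝ) :=
    Real.one_le_rpow (by nlinarith [sq_nonneg s.im]) (by norm_num)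
  have hprod : 1 ≤ Real.log q * (1 + s.im ^ 2) ^ (1 / 4 : ℝ) :=
    one_le_mul_of_one_le_of_one_le hlog hone
  rcases le_or_gt 2 s.re with h2 | h2
  · have h0 : (0 : ℝ) ≤ max C 2610 := le_max_of_le_right (by norm_num)
    calc _ ≤ C := hC q χ s h2
      _ ≤ max C 2610 * 1 := by rw [mul_one]; exact le_max_left _ _
      _ ≤ max C 2610 * (Real.log q * (1 + s.im ^ 2) ^ (1 / 4 : ℝ)) :=
          mul_le_mul_of_nonneg_left hprod h0
      _ = _ := by ring
  -- discs about `2 + i * Im s`: radius `29/20` stays in `Re w > 1/2`, radius `5/4` reaches `3/4`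
  set c : ℂ := ⟨2, s.im⟩ with hc
  have hq0 : (0 : ℝ) < q := by positivity
  have hball {w : ℂ} (hw : w ∈ ball c (29 / 20)) :
      1 / 2 < w.re ∧ ‖w‖ ≤ |s.im| + 4 := by
    have hd : ‖w - c‖ < 29 / 20 := by simpa [dist_eq_norm] using hw
    constructor
    · have := (abs_le.mp (abs_re_le_norm (w - c))).1
      simp only [hc, sub_re] at this
      linarith
    · have hcn : ‖c‖ ≤ 2 + |s.im| := by
        refine (norm_le_abs_re_add_abs_im c).trans (le_of_eq ?_)
        simp [hc]
      calc ‖w‖ = ‖(w - c) + c‖ := by ring_nf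
        _ ≤ ‖w - c‖ + ‖c‖ := norm_add_le _ _
        _ ≤ _ := by linarith
  have ht4 : (4 : ℝ) ≤ |s.im| + 4 := by linarith [abs_nonneg s.im]
  have hM : 0 < Real.log (4 * q * (|s.im| + 4)) := by
    refine Real.log_pos ?_
    have : (3 : ℝ) ≤ q := by exact_mod_cast hq
    nlinarith
  have h := norm_deriv_div_le_of_norm_le_exp_mul (f := χ.LFunction) (c := c) (r := 5 / 4)
    (R := 29 / 20) (z := s) hM (by norm_num)
    (DirichletCharacter.differentiable_LFunction hχ).differentiableOn
    (fun w hw => LFunction_ne_zero_of_GRHFor hχ hG (hball hw).1) (fun w hw => ?_) ?_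
  · refine h.trans ?_
    have hlogM : Real.log (4 * q * (|s.im| + 4)) ≤
        9 * (Real.log q * (1 + s.im ^ 2) ^ (1 / 4 : ℝ)) := by
      rw [Real.log_mul (by positivity) (by positivity), Real.log_mul (by norm_num) (by positivity)]
      have h1 := log_abs_add_four_le s.im
      have h4 : Real.log 4 ≤ 2 := by
        rw [show (4 : ℝ) = 2 ^ 2 by norm_num, Real.log_pow]
        have := Real.log_two_lt_d9
        push_cast
        linarith
      nlinarith
    calc 8 * Real.log (4 * q * (|s.im| + 4)) * (29 / 20) / (29 / 20 - 5 / 4) ^ 2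
        = 290 * Real.log (4 * q * (|s.im| + 4)) := by ring
      _ ≤ 2610 * (Real.log q * (1 + s.im ^ 2) ^ (1 / 4 : ℝ)) := by linarith
      _ ≤ max C 2610 * (Real.log q * (1 + s.im ^ 2) ^ (1 / 4 : ℝ)) :=
          mul_le_mul_of_nonneg_right (le_max_right _ _) (by linarith)
      _ = _ := by ring
  · obtain ⟨hre, hnorm⟩ := hball hw
    rw [Real.exp_log (by positivity)]
    have hL := one_le_two_mul_norm_LFunction χ (s := c) (by simp [hc])
    calc ‖χ.LFunction w‖ ≤ ‖w‖ * (q / w.re) := norm_LFunction_le hχ (by linarith)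
      _ ≤ (|s.im| + 4) * (2 * q) := by
          refine mul_le_mul hnorm ?_ (by positivity) (by positivity)
          rw [div_le_iff₀ (by linarith)]
          nlinarith
      _ = (4 * q * (|s.im| + 4)) / 2 * 1 := by ring
      _ ≤ (4 * q * (|s.im| + 4)) / 2 * (2 * ‖χ.LFunction c‖) :=
          mul_le_mul_of_nonneg_left hL (by positivity)
      _ = _ := by ring
  · have hsc : s - c = ((s.re - 2 : ℝ) : ℂ) := by
      apply Complex.ext <;> simp [hc]
    rw [mem_closedBall, dist_eq_norm, hsc, norm_real, Real.norm_eq_abs, abs_le]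
    constructor <;> linarith

/-! ### Perron's formula for Riesz means -/

open Complex in
theorem norm_inv_mul_le_inv_one_add_sq (t : ℝ) :
    ‖1 / ((1 + t * I : ℂ) * (2 + t * I))‖ ≤ (1 + t ^ 2)⁻¹ := by
  have h1 : √(1 + t ^ 2) ≤ ‖(1 + t * I : ℂ)‖ := by
    rw [norm_def, normSq_apply]
    refine Real.sqrt_le_sqrt ?_
    simp
    nlinarith
  have h2 : √(1 + t ^ 2) ≤ ‖(2 + t * I : ℂ)‖ := by
    rw [norm_def, normSq_apply]
    refine Real.sqrt_le_sqrt ?_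
    simp
    nlinarith
  have h0 : 0 < 1 + t ^ 2 := by positivity
  rw [norm_div, norm_one, norm_mul, one_div]
  refine inv_anti₀ h0 ?_
  calc 1 + t ^ 2 = √(1 + t ^ 2) * √(1 + t ^ 2) := (Real.mul_self_sqrt h0.le).symm
    _ ≤ _ := mul_le_mul h1 h2 (Real.sqrt_nonneg _) (norm_nonneg _)

open Complex in
theorem one_add_mul_I_ne_zero (t : ℝ) : (1 + t * I : ℂ) ≠ 0 := fun h => by
  simpa using congrArg re h

open Complex in
theorem two_add_mul_I_ne_zero (t : ℝ) : (2 + t * I : ℂ) ≠ 0 := fun h => by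
  simpa using congrArg re h

open Complex MeasureTheory in
theorem integrable_one_div_mul_vertical :
    Integrable fun t : ℝ => 1 / ((1 + t * I : ℂ) * (2 + t * I)) := by
  refine integrable_inv_one_add_sq.mono' ?_ (.of_forall norm_inv_mul_le_inv_one_add_sq)
  refine Continuous.aestronglyMeasurable ?_
  refine continuous_const.div (by fun_prop) fun t =>
    mul_ne_zero (one_add_mul_I_ne_zero t) (two_add_mul_I_ne_zero t)

open Complex MeasureTheory in
/-- Mellin inversion for the weight `max (1 - u) 0`, whose Mellin transform is
`1 / (s * (s + 1))`. -/
theorem max_one_sub_eq_integral {u : ℝ} (hu : 0 < u) :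
    ((max (1 - u) 0 : ℝ) : ℂ) = (1 / (2 * Real.pi) : ℝ) •
      ∫ t : ℝ, (u : ℂ) ^ (-(1 + t * I)) * (1 / ((1 + t * I) * (2 + t * I))) := by
  set h : ℝ → ℂ := fun t => (Set.Ioc 0 1).indicator (fun _ => 1 : ℝ → ℂ) t
    - (Set.Ioc 0 1).indicator (fun t => (t : ℂ) ^ (1 : ℂ) : ℝ → ℂ) t with hh
  have hval (t : ℝ) (ht : 0 < t) : h t = ((max (1 - t) 0 : ℝ) : ℂ) := by
    by_cases ht1 : t ≤ 1
    · have : (0 : ℝ) ≤ 1 - t := by linarith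
      simp [hh, Set.indicator, ht, ht1]
    · have : 1 - t ≤ 0 := by linarith
      simp [hh, Set.indicator, ht1, max_eq_right this]
  have hmel (s : ℂ) (hs : 0 < s.re) : HasMellin h s (1 / (s * (s + 1))) := by
    have h1 := hasMellin_one_Ioc hs
    have h2 := hasMellin_cpow_Ioc 1 (s := s) (by simp; linarith)
    have h3 := hasMellin_sub h1.1 h2.1
    rw [h1.2, h2.2] at h3
    have hs0 : s ≠ 0 := fun h => by simp [h] at hs
    have hs1 : s + 1 ≠ 0 := fun h => by
      have := congrArg re h
      simp at this
      linarith
    have e : 1 / (s * (s + 1)) = 1 / s - 1 / (s + 1) := by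
      rw [div_sub_div _ _ hs0 hs1]
      ring
    rw [e]
    exact h3
  have hline (t : ℝ) : mellin h (1 + t * I) = 1 / ((1 + t * I) * (2 + t * I)) := by
    rw [(hmel _ (by simp)).2]
    ring
  have hvert : VerticalIntegrable (mellin h) 1 := by
    simp only [VerticalIntegrable, ofReal_one, hline]
    exact integrable_one_div_mul_vertical
  have hcont : ContinuousAt h u := by
    have : ContinuousAt (fun t : ℝ => ((max (1 - t) 0 : ℝ) : ℂ)) u := by fun_prop
    refine this.congr ?_
    filter_upwards [Ioi_mem_nhds hu] with t ht using (hval t ht).symm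
  have := mellinInv_mellin_eq 1 h hu (hmel _ (by simp)).1 hvert hcont
  rw [← hval u hu, ← this, mellinInv]
  simp only [ofReal_one, hline, smul_eq_mul]

/-- The Riesz mean `∑ n ≤ x, a n * (1 - n / x)`; the term `n = 0` is left out. -/
noncomputable def rieszMean (a : ℕ → ℂ) (x : ℝ) : ℂ :=
  ∑ n ∈ Finset.Icc 1 ⌊x⌋₊, a n * ((1 - n / x : ℝ) : ℂ)

open Complex MeasureTheory in
/-- **Perron's formula** for Riesz means. -/
theorem rieszMean_eq_integral {a : ℕ → ℂ} (ha : LSeriesSummable a 1) {x : ℝ}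
    (hx : 0 < x) :
    rieszMean a x = (1 / (2 * Real.pi) : ℝ) •
      ∫ t : ℝ, LSeries a (1 + t * I) * ((x : ℂ) ^ (1 + t * I) / ((1 + t * I) * (2 + t * I))) := by
  set F : ℕ → ℝ → ℂ := fun n t =>
    LSeries.term a (1 + t * I) n * ((x : ℂ) ^ (1 + t * I) / ((1 + t * I) * (2 + t * I))) with hF
  have hterm (n : ℕ) (t : ℝ) : ‖LSeries.term a (1 + t * I) n‖ = ‖LSeries.term a 1 n‖ := by
    simp [LSeries.norm_term_eq]
  have hnorm (n : ℕ) (t : ℝ) :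
      ‖F n t‖ = ‖LSeries.term a 1 n‖ * x * ‖1 / ((1 + t * I : ℂ) * (2 + t * I))‖ := by
    rw [hF]
    simp only
    rw [norm_mul, hterm, div_eq_mul_one_div, norm_mul, norm_cpow_eq_rpow_re_of_pos hx]
    simp [mul_assoc]
  have hcontK : Continuous fun t : ℝ => (x : ℂ) ^ (1 + t * I) / ((1 + t * I) * (2 + t * I)) := by
    refine Continuous.div ?_ (by fun_prop) fun t =>
      mul_ne_zero (one_add_mul_I_ne_zero t) (two_add_mul_I_ne_zero t)
    exact Continuous.const_cpow (by fun_prop) (Or.inl (by exact_mod_cast hx.ne'))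
  have hFc (n : ℕ) : Continuous (F n) := by
    refine Continuous.mul ?_ hcontK
    rcases eq_or_ne n 0 with rfl | hn
    · simpa using continuous_const
    · simp only [LSeries.term_of_ne_zero hn]
      have hn' : (n : ℂ) ≠ 0 := by exact_mod_cast hn
      refine continuous_const.div (Continuous.const_cpow (by fun_prop) (Or.inl hn')) fun t => ?_
      simp [cpow_eq_zero_iff, hn']
  have hFint (n : ℕ) : Integrable (F n) := by
    refine (integrable_one_div_mul_vertical.norm.const_mul (‖LSeries.term a 1 n‖ * x)).mono'
      (hFc n).aestronglyMeasurable (.of_forall fun t => (hnorm n t).le)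
  have hsum : Summable fun n => ∫ t, ‖F n t‖ := by
    simp only [hnorm, integral_const_mul]
    exact (ha.norm.mul_right x).mul_right _
  have hmain := hasSum_integral_of_summable_integral_norm hFint hsum
  have hrhs : ∫ t : ℝ, ∑' n, F n t = ∫ t : ℝ,
      LSeries a (1 + t * I) * ((x : ℂ) ^ (1 + t * I) / ((1 + t * I) * (2 + t * I))) := by
    simp only [hF, tsum_mul_right, LSeries]
  rw [hrhs] at hmain
  have hmain' := hmain.const_smul (1 / (2 * Real.pi) : ℝ)
  have hval (n : ℕ) : (1 / (2 * Real.pi) : ℝ) • ∫ t : ℝ, F n t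
      = if n = 0 then 0 else a n * ((max (1 - n / x) 0 : ℝ) : ℂ) := by
    split_ifs with hn
    · simp [hF, hn]
    · have hn0 : (0 : ℝ) < n := by exact_mod_cast Nat.pos_of_ne_zero hn
      rw [max_one_sub_eq_integral (div_pos hn0 hx), mul_smul_comm, ← integral_const_mul]
      congr 2
      ext t
      simp only [hF, LSeries.term_of_ne_zero hn]
      have hxc : (x : ℂ) ≠ 0 := by exact_mod_cast hx.ne'
      have hcp : ((n / x : ℝ) : ℂ) ^ (-(1 + t * I)) =
          (x : ℂ) ^ (1 + t * I) / (n : ℂ) ^ (1 + t * I) := by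
        rw [div_eq_mul_inv, ofReal_mul, mul_cpow_ofReal_nonneg hn0.le (inv_nonneg.mpr hx.le),
          ofReal_inv, ofReal_natCast, cpow_neg, inv_cpow _ _ (by
            rw [arg_ofReal_of_nonneg hx.le]; exact Real.pi_pos.ne), cpow_neg, inv_inv]
        ring
      rw [hcp]
      ring
  rw [← hmain'.tsum_eq, rieszMean]
  simp only [hval]
  rw [tsum_eq_sum (s := Finset.Icc 1 ⌊x⌋₊)]
  · refine Finset.sum_congr rfl fun n hn => ?_
    have hn1 := Finset.mem_Icc.mp hn
    have hnx : (n : ℝ) ≤ x := (Nat.le_floor_iff hx.le).mp hn1.2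
    have : (0 : ℝ) ≤ 1 - n / x := by
      rw [sub_nonneg, div_le_one hx]
      exact hnx
    rw [if_neg (by omega), max_eq_left this]
  · intro n hn
    split_ifs with h0
    · rfl
    · have hlt : ⌊x⌋₊ < n := by
        by_contra! h
        exact hn (Finset.mem_Icc.mpr ⟨Nat.one_le_iff_ne_zero.mpr h0, h⟩)
      have hnx : x < n := (Nat.floor_lt hx.le).mp hlt
      have : (1 - n / x : ℝ) ≤ 0 := by
        rw [sub_nonpos, one_le_div hx]
        exact hnx.le
      simp [max_eq_right this]

/-! ### Moving the line of integration -/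

open Complex MeasureTheory Filter in
/-- Cauchy's theorem on the rectangles with corners `a - iT` and `b + iT`, as `T → ∞`. -/
theorem integral_vertical_line_eq_of_differentiableOn {G : ℂ → ℂ} {a b : ℝ} (hab : a ≤ b)
    (hG : DifferentiableOn ℂ G {s | a ≤ s.re ∧ s.re ≤ b})
    (ha : Integrable fun t : ℝ => G (a + t * I)) (hb : Integrable fun t : ℝ => G (b + t * I))
    {m : ℝ → ℝ} (hm : Tendsto m atTop (nhds 0))
    (hGm : ∀ s : ℂ, a ≤ s.re → s.re ≤ b → 1 ≤ |s.im| → ‖G s‖ ≤ m |s.im|) :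
    ∫ t : ℝ, G (a + t * I) = ∫ t : ℝ, G (b + t * I) := by
  have hrect (T : ℝ) : (∫ x in a..b, G (x + (-T : ℝ) * I)) - (∫ x in a..b, G (x + T * I))
      + I * (∫ y in -T..T, G (b + y * I)) - I * (∫ y in -T..T, G (a + y * I)) = 0 := by
    have h := integral_boundary_rect_eq_zero_of_differentiableOn G ⟨a, -T⟩ ⟨b, T⟩
      (hG.mono fun s hs => by
        have h1 := (mem_reProdIm.mp hs).1
        simp only [Set.uIcc_of_le hab] at h1
        exact h1)
    exact h
  have hvert {c : ℝ} (hc : Integrable fun t : ℝ => G (c + t * I)) :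
      Tendsto (fun T : ℝ => I * ∫ y in -T..T, G (c + y * I)) atTop
        (nhds (I * ∫ t : ℝ, G (c + t * I))) := by
    have h : Tendsto (fun T : ℝ => ∫ y in -T..T, G (c + y * I)) atTop
        (nhds (∫ t : ℝ, G (c + t * I))) :=
      intervalIntegral_tendsto_integral (a := fun T : ℝ => -T) (b := fun T : ℝ => T) hc
        tendsto_neg_atTop_atBot tendsto_id
    exact h.const_mul I
  have hhor {ε : ℝ} (hε : |ε| = 1) :
      Tendsto (fun T : ℝ => ∫ x in a..b, G (x + (ε * T : ℝ) * I)) atTop (nhds 0) := by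
    refine squeeze_zero_norm' (a := fun T => m T * |b - a|) ?_ (by simpa using hm.mul_const |b - a|)
    filter_upwards [eventually_ge_atTop 1] with T hT
    have hT' : |ε * T| = T := by rw [abs_mul, hε, one_mul, abs_of_nonneg (by linarith)]
    refine intervalIntegral.norm_integral_le_of_norm_le_const fun x hx => ?_
    rw [Set.uIoc_of_le hab] at hx
    have him : ((x : ℂ) + (ε * T : ℝ) * I).im = ε * T := by simp
    have hre : ((x : ℂ) + (ε * T : ℝ) * I).re = x := by simp
    have h := hGm (x + (ε * T : ℝ) * I) (by rw [hre]; exact hx.1.le) (by rw [hre]; exact hx.2)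
      (by rw [him, hT']; exact hT)
    rwa [him, hT'] at h
  have h1 := hhor (ε := -1) (by simp)
  have h2 := hhor (ε := 1) (by simp)
  simp only [neg_mul, one_mul] at h1 h2
  have hlim := (((h1.sub h2).add (hvert hb)).sub (hvert ha)).congr hrect
  have h0 := tendsto_nhds_unique hlim tendsto_const_nhds
  rw [sub_zero, zero_add, sub_eq_zero] at h0
  exact (mul_left_cancel₀ I_ne_zero h0).symm

open Complex in
theorem sqrt_one_add_im_sq_le {s : ℂ} (h : 1 / 4 ≤ |s.re| ∨ 1 ≤ |s.im|) :
    √(1 + s.im ^ 2) ≤ 4 * ‖s‖ := by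
  rw [← Real.sqrt_sq (by positivity : 0 ≤ 4 * ‖s‖), mul_pow, Complex.sq_norm, normSq_apply]
  refine Real.sqrt_le_sqrt ?_
  rcases h with h | h
  · have := mul_self_le_mul_self (by norm_num) h
    rw [abs_mul_abs_self] at this
    nlinarith
  · have := mul_self_le_mul_self (by norm_num) h
    rw [abs_mul_abs_self] at this
    nlinarith [mul_self_nonneg s.re]

theorem integrable_one_add_sq_rpow :
    MeasureTheory.Integrable fun t : ℝ => (1 + t ^ 2) ^ (-(3 / 4) : ℝ) := by
  have := integrable_rpow_neg_one_add_norm_sq (E := ℝ) (r := 3 / 2)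
    (μ := MeasureTheory.volume) (by norm_num)
  refine this.congr (.of_forall fun t => ?_)
  simp only [Real.norm_eq_abs, sq_abs]
  norm_num

open Complex MeasureTheory Filter in
/-- The kernel `(x ^ s - y ^ s) / (s * (s + 1))` has no pole at `s = 0`, so the line of integration
moves to `Re s = -1/4`, where the kernel decays in `x` and `y`. -/
theorem norm_integral_mul_cpow_sub_cpow_le {F : ℂ → ℂ} {B : ℝ} (hB : 0 ≤ B)
    (hF : DifferentiableOn ℂ F {s | -(1 / 2) < s.re})
    (hFB : ∀ s : ℂ, -(1 / 4) ≤ s.re → ‖F s‖ ≤ B * (1 + s.im ^ 2) ^ (1 / 4 : ℝ))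
    {x y : ℝ} (hx : 1 ≤ x) (hy : 1 ≤ y) :
    (Integrable fun t : ℝ => F (1 + t * I) *
        ((x : ℂ) ^ (1 + t * I) / ((1 + t * I) * (2 + t * I)))) ∧
    ‖∫ t : ℝ, F (1 + t * I) * (((x : ℂ) ^ (1 + t * I) - (y : ℂ) ^ (1 + t * I)) /
        ((1 + t * I) * (2 + t * I)))‖ ≤
      16 * B * (x ^ (-(1 / 4) : ℝ) + y ^ (-(1 / 4) : ℝ)) *
        ∫ t : ℝ, (1 + t ^ 2) ^ (-(3 / 4) : ℝ) := by
  have hx0 : 0 < x := by linarith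
  have hy0 : 0 < y := by linarith
  have hxc : (x : ℂ) ≠ 0 := by exact_mod_cast hx0.ne'
  have hyc : (y : ℂ) ≠ 0 := by exact_mod_cast hy0.ne'
  -- a bound that serves both vertical lines and the horizontal sides
  have hkernel {s : ℂ} (hs : -(1 / 4) ≤ s.re) (h : 1 / 4 ≤ |s.re| ∨ 1 ≤ |s.im|) (w : ℂ) :
      ‖F s * (w / (s * (s + 1)))‖ ≤ 16 * B * ‖w‖ * (1 + s.im ^ 2) ^ (-(3 / 4) : ℝ) := by
    have h0 : 0 < 1 + s.im ^ 2 := by positivity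
    have h1 := sqrt_one_add_im_sq_le h
    have h2 := sqrt_one_add_im_sq_le (s := s + 1) (Or.inl (by
      rw [add_re, one_re, abs_of_nonneg (by linarith)]; linarith))
    rw [add_im, one_im, add_zero] at h2
    have h3 : (1 + s.im ^ 2) / 16 ≤ ‖s‖ * ‖s + 1‖ := by
      have := mul_le_mul h1 h2 (Real.sqrt_nonneg _) (by positivity)
      rw [Real.mul_self_sqrt h0.le] at this
      linarith
    rw [norm_mul, norm_div, norm_mul]
    calc ‖F s‖ * (‖w‖ / (‖s‖ * ‖s + 1‖))
        ≤ (B * (1 + s.im ^ 2) ^ (1 / 4 : ℝ)) * (‖w‖ / ((1 + s.im ^ 2) / 16)) := by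
          refine mul_le_mul (hFB s hs) ?_ (by positivity) (by positivity)
          exact div_le_div_of_nonneg_left (norm_nonneg _) (by positivity) h3
      _ = 16 * B * ‖w‖ * ((1 + s.im ^ 2) ^ (1 / 4 : ℝ) / (1 + s.im ^ 2)) := by
          field_simp
      _ = _ := by
          rw [← Real.rpow_sub_one h0.ne']
          norm_num
  have hlineF {c : ℝ} (hc : -(1 / 2) < c) : Continuous fun t : ℝ => F (c + t * I) := by
    refine hF.continuousOn.comp_continuous (by fun_prop) fun t => ?_
    simpa using hc
  have hcpow {z : ℂ} (hz : z ≠ 0) (c : ℝ) : Continuous fun t : ℝ => z ^ ((c : ℂ) + t * I) :=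
    Continuous.const_cpow (by fun_prop) (Or.inl hz)
  have hline {c : ℝ} (hc : -(1 / 4) ≤ c) (hc' : 1 / 4 ≤ |c|) (hc1 : c ≠ 0) (hc2 : c + 1 ≠ 0)
      {w : ℝ → ℂ} (hw : Continuous w) {W : ℝ} (hwW : ∀ t, ‖w t‖ ≤ W) :
      (Integrable fun t : ℝ => F (c + t * I) * (w t / ((c + t * I) * (c + t * I + 1)))) ∧
      ‖∫ t : ℝ, F (c + t * I) * (w t / ((c + t * I) * (c + t * I + 1)))‖ ≤
        16 * B * W * ∫ t : ℝ, (1 + t ^ 2) ^ (-(3 / 4) : ℝ) := by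
    have hb (t : ℝ) : ‖F (c + t * I) * (w t / ((c + t * I) * (c + t * I + 1)))‖ ≤
        16 * B * W * (1 + t ^ 2) ^ (-(3 / 4) : ℝ) := by
      have h := hkernel (s := c + t * I) (by simpa using hc) (Or.inl (by simpa using hc')) (w t)
      simp only [add_im, ofReal_im, mul_im, ofReal_re, I_im, mul_one, I_re, mul_zero, add_zero,
        zero_add] at h
      refine h.trans (mul_le_mul_of_nonneg_right ?_ (by positivity))
      exact mul_le_mul_of_nonneg_left (hwW t) (by positivity)
    have hint := integrable_one_add_sq_rpow.const_mul (16 * B * W)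
    refine ⟨hint.mono' (Continuous.aestronglyMeasurable ?_) (.of_forall hb), ?_⟩
    · refine (hlineF (by linarith)).mul (hw.div (by fun_prop) fun t => ?_)
      refine mul_ne_zero (fun h => hc1 ?_) (fun h => hc2 ?_)
      · simpa using congrArg re h
      · simpa using congrArg re h
    · rw [← integral_const_mul]
      exact norm_integral_le_of_norm_le hint (.of_forall hb)
  have hnormcpow {x : ℝ} (hx0 : 0 < x) (c t : ℝ) : ‖(x : ℂ) ^ ((c : ℂ) + t * I)‖ = x ^ c := by
    rw [norm_cpow_eq_rpow_re_of_pos hx0]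
    simp
  refine ⟨?_, ?_⟩
  · have h := (hline (c := 1) (by norm_num) (by norm_num) (by norm_num) (by norm_num)
      (hcpow hxc 1) (fun t => (hnormcpow hx0 1 t).le)).1
    refine h.congr (.of_forall fun t => ?_)
    simp only [ofReal_one]
    congr 3
    ring
  -- the integrand, with the removable singularity at `0` filled in
  set Q : ℂ → ℂ := fun s => F s * (dslope (fun s => (x : ℂ) ^ s - (y : ℂ) ^ s) 0 s / (s + 1))
    with hQ
  have hQval {s : ℂ} (hs : s ≠ 0) :
      Q s = F s * (((x : ℂ) ^ s - (y : ℂ) ^ s) / (s * (s + 1))) := by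
    simp only [hQ, dslope_of_ne _ hs, slope_def_field, cpow_zero, sub_self, sub_zero]
    rw [div_div]
  have hcp {z : ℂ} (hz : z ≠ 0) : Differentiable ℂ fun s : ℂ => z ^ s :=
    fun s => differentiableAt_id.const_cpow (Or.inl hz)
  have hdiffcp : DifferentiableOn ℂ (fun s : ℂ => (x : ℂ) ^ s - (y : ℂ) ^ s) Set.univ :=
    ((hcp hxc).fun_sub (hcp hyc)).differentiableOn
  have hQd : DifferentiableOn ℂ Q {s | -(1 / 4) ≤ s.re ∧ s.re ≤ 1} := by
    refine (hF.mono fun s hs => ?_).mul (DifferentiableOn.div ?_ ?_ fun s hs h => ?_)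
    · have := hs.1
      simp only [Set.mem_ofPred_eq]
      linarith
    · exact ((differentiableOn_dslope univ_mem).mpr hdiffcp).mono (Set.subset_univ _)
    · exact differentiableOn_id.add_const 1
    · have h1 := congrArg re h
      simp only [add_re, one_re, zero_re] at h1
      linarith [hs.1]
  have hlineQ {c : ℝ} (hc : c ≠ 0) (t : ℝ) : Q (c + t * I) =
      F (c + t * I) * (((x : ℂ) ^ ((c : ℂ) + t * I) - (y : ℂ) ^ ((c : ℂ) + t * I)) /
        ((c + t * I) * (c + t * I + 1))) :=
    hQval fun h => hc (by simpa using congrArg re h)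
  have hnum (c : ℝ) (t : ℝ) :
      ‖(x : ℂ) ^ ((c : ℂ) + t * I) - (y : ℂ) ^ ((c : ℂ) + t * I)‖ ≤ x ^ c + y ^ c := by
    refine (norm_sub_le _ _).trans (le_of_eq ?_)
    rw [hnormcpow hx0, hnormcpow hy0]
  have hleft := hline (c := -(1 / 4)) le_rfl (by rw [abs_neg]; norm_num) (by norm_num)
    (by norm_num) ((hcpow hxc _).sub (hcpow hyc _)) (hnum (-(1 / 4)))
  have hright := hline (c := 1) (by norm_num) (by norm_num) (by norm_num)
    (by norm_num) ((hcpow hxc _).sub (hcpow hyc _)) (hnum 1)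
  have hm : Tendsto (fun t : ℝ => 16 * B * (x + y) * (1 + t ^ 2) ^ (-(3 / 4) : ℝ)) atTop
      (nhds 0) := by
    have h1 : Tendsto (fun t : ℝ => 1 + t ^ 2) atTop atTop :=
      tendsto_atTop_add_const_left _ _ (tendsto_pow_atTop two_ne_zero)
    have h2 := (tendsto_rpow_neg_atTop (y := 3 / 4) (by norm_num)).comp h1
    simpa using h2.const_mul (16 * B * (x + y))
  have hshift := integral_vertical_line_eq_of_differentiableOn (G := Q) (a := -(1 / 4)) (b := 1)
    (by norm_num) hQd (hleft.1.congr (.of_forall fun t => (hlineQ (by norm_num) t).symm))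
    (hright.1.congr (.of_forall fun t => (hlineQ (by norm_num) t).symm)) hm
    (fun s h1 h2 h3 => by
      have hs0 : s ≠ 0 := fun h => by simp [h] at h3; linarith
      rw [hQval hs0, sq_abs]
      refine (hkernel h1 (Or.inr h3) _).trans
        (mul_le_mul_of_nonneg_right ?_ (by positivity))
      refine mul_le_mul_of_nonneg_left ?_ (by positivity)
      refine (norm_sub_le _ _).trans ?_
      rw [norm_cpow_eq_rpow_re_of_pos hx0, norm_cpow_eq_rpow_re_of_pos hy0]
      have e1 := Real.rpow_le_rpow_of_exponent_le hx h2
      have e2 := Real.rpow_le_rpow_of_exponent_le hy h2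
      rw [Real.rpow_one] at e1 e2
      linarith)
  have hfin : ∫ t : ℝ, F (1 + t * I) * (((x : ℂ) ^ (1 + t * I) - (y : ℂ) ^ (1 + t * I)) /
        ((1 + t * I) * (2 + t * I))) = ∫ t : ℝ, Q (((1 : ℝ) : ℂ) + t * I) := by
    congr 1
    ext t
    rw [hlineQ one_ne_zero]
    simp only [ofReal_one]
    congr 3
    ring
  rw [hfin, ← hshift]
  simp only [hlineQ (show (-(1 / 4) : ℝ) ≠ 0 by norm_num)]
  exact hleft.2

/-! ### Sums over primes twisted by `χ` -/

open ArithmeticFunction in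
/-- The coefficients of `-L'/L(s + σ, χ)` as a Dirichlet series in `s`. -/
noncomputable def twistedVonMangoldt {q : ℕ} (χ : DirichletCharacter ℂ q) (σ : ℝ) (n : ℕ) : ℂ :=
  χ n * ((vonMangoldt n * (n : ℝ) ^ (-σ) : ℝ) : ℂ)

open ArithmeticFunction in
theorem vonMangoldt_mul_rpow_nonneg (σ : ℝ) (n : ℕ) : 0 ≤ vonMangoldt n * (n : ℝ) ^ (-σ) :=
  mul_nonneg vonMangoldt_nonneg (by positivity)

open ArithmeticFunction in
theorem vonMangoldt_mul_rpow_le_div {σ : ℝ} (hσ : 1 ≤ σ) (n : ℕ) :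
    vonMangoldt n * (n : ℝ) ^ (-σ) ≤ vonMangoldt n / n := by
  rcases n.eq_zero_or_pos with rfl | hn
  · simp
  rw [div_eq_mul_inv, ← Real.rpow_neg_one]
  have : (1 : ℝ) ≤ n := by exact_mod_cast hn
  exact mul_le_mul_of_nonneg_left (Real.rpow_le_rpow_of_exponent_le this (by linarith))
    vonMangoldt_nonneg

open ArithmeticFunction in
theorem norm_twistedVonMangoldt_le {q : ℕ} (χ : DirichletCharacter ℂ q) {σ : ℝ} (hσ : 1 ≤ σ)
    (n : ℕ) : ‖twistedVonMangoldt χ σ n‖ ≤ vonMangoldt n / n := by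
  rw [twistedVonMangoldt, norm_mul, Complex.norm_real, Real.norm_eq_abs,
    abs_of_nonneg (vonMangoldt_mul_rpow_nonneg σ n)]
  exact (mul_le_of_le_one_left (vonMangoldt_mul_rpow_nonneg σ n) (χ.norm_le_one _)).trans
    (vonMangoldt_mul_rpow_le_div hσ n)

open ArithmeticFunction Complex in
theorem term_twistedVonMangoldt {q : ℕ} (χ : DirichletCharacter ℂ q) (σ : ℝ) (s : ℂ) (n : ℕ) :
    LSeries.term (twistedVonMangoldt χ σ) s n
      = LSeries.term (((χ ·) : ℕ → ℂ) * fun n => (vonMangoldt n : ℂ)) (s + σ) n := by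
  rcases eq_or_ne n 0 with rfl | hn
  · simp
  have hn' : (n : ℂ) ≠ 0 := by exact_mod_cast hn
  rw [LSeries.term_of_ne_zero hn, LSeries.term_of_ne_zero hn, twistedVonMangoldt, cpow_add _ _ hn',
    ofReal_mul, ofReal_cpow (Nat.cast_nonneg n), ofReal_neg, cpow_neg, Pi.mul_apply]
  simp only [ofReal_natCast]
  field_simp

open ArithmeticFunction Complex MeasureTheory in
/-- The power saving from GRH, in smoothed form. Taking a difference of two Riesz means cancels the
value of `L'/L` at `σ`, for which no bound better than `O(log q)` is at hand. -/
theorem exists_norm_rieszMean_sub_rieszMean_le :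
    ∃ K : ℝ, 0 ≤ K ∧ ∀ (q : ℕ) [NeZero q] (χ : DirichletCharacter ℂ q), 3 ≤ q → χ ≠ 1 → GRHFor χ →
      ∀ σ x y : ℝ, 1 ≤ σ → 1 ≤ x → 1 ≤ y →
        ‖rieszMean (twistedVonMangoldt χ σ) x - rieszMean (twistedVonMangoldt χ σ) y‖ ≤
          K * Real.log q * (x ^ (-(1 / 4) : ℝ) + y ^ (-(1 / 4) : ℝ)) := by
  obtain ⟨K, hK0, hK⟩ := exists_norm_deriv_LFunction_div_le_of_GRHFor
  set J : ℝ := ∫ t : ℝ, (1 + t ^ 2) ^ (-(3 / 4) : ℝ) with hJ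
  have hJ0 : 0 ≤ J := integral_nonneg fun t => by positivity
  refine ⟨1 / (2 * Real.pi) * (16 * K * J), by positivity [Real.pi_pos],
    fun q _ χ hq hχ hG σ x y hσ hx hy => ?_⟩
  set F : ℂ → ℂ := fun s => -(deriv χ.LFunction (s + σ) / χ.LFunction (s + σ)) with hF
  have hlog : 1 ≤ Real.log q := one_le_log_natCast hq
  have hLd := DirichletCharacter.differentiable_LFunction hχ
  have hLd' : Differentiable ℂ (deriv χ.LFunction) :=
    fun s => (hLd.analyticAt s).deriv.differentiableAt
  have hFd : DifferentiableOn ℂ F {s | -(1 / 2) < s.re} := by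
    intro s hs
    have hs' : -(1 / 2) < s.re := hs
    have h0 : χ.LFunction (s + σ) ≠ 0 := LFunction_ne_zero_of_GRHFor hχ hG (by
      rw [add_re, ofReal_re]
      linarith)
    have hadd : DifferentiableAt ℂ (fun s : ℂ => s + σ) s := differentiableAt_id.add_const _
    have h1 : DifferentiableAt ℂ (fun s : ℂ => χ.LFunction (s + σ)) s :=
      (hLd (s + σ)).comp s hadd
    have h2 : DifferentiableAt ℂ (fun s : ℂ => deriv χ.LFunction (s + σ)) s :=
      DifferentiableAt.comp (g := deriv χ.LFunction) s (hLd' (s + σ)) hadd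
    exact (h2.fun_div h1 h0).fun_neg.differentiableWithinAt
  have hFB (s : ℂ) (hs : -(1 / 4) ≤ s.re) :
      ‖F s‖ ≤ K * Real.log q * (1 + s.im ^ 2) ^ (1 / 4 : ℝ) := by
    have h := hK q χ hq hχ hG (s + σ) (by rw [add_re, ofReal_re]; linarith)
    rw [add_im, ofReal_im, add_zero] at h
    rwa [hF, norm_neg]
  have hB : 0 ≤ K * Real.log q := by positivity
  have hLS (t : ℝ) : LSeries (twistedVonMangoldt χ σ) (1 + t * I) = F (1 + t * I) := by
    have hre : 1 < (1 + t * I + σ : ℂ).re := by simp; linarith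
    have h := DirichletCharacter.LSeries_twist_vonMangoldt_eq χ hre
    rw [← χ.deriv_LFunction_eq_deriv_LSeries hre, ← χ.LFunction_eq_LSeries hre, neg_div] at h
    simp only [hF]
    rw [← h]
    exact tsum_congr fun n => term_twistedVonMangoldt χ σ _ n
  have hsum : LSeriesSummable (twistedVonMangoldt χ σ) 1 := by
    have h := χ.LSeriesSummable_twist_vonMangoldt (s := 1 + σ) (by simp; linarith)
    exact h.congr fun n => (term_twistedVonMangoldt χ σ 1 n).symm
  rw [rieszMean_eq_integral hsum (by linarith), rieszMean_eq_integral hsum (by linarith),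
    ← smul_sub]
  simp only [hLS]
  have hX := norm_integral_mul_cpow_sub_cpow_le hB hFd hFB hx hy
  have hY := norm_integral_mul_cpow_sub_cpow_le hB hFd hFB hy hx
  rw [← integral_sub hX.1 hY.1, norm_smul, Real.norm_eq_abs,
    abs_of_nonneg (by positivity [Real.pi_pos])]
  calc _ = 1 / (2 * Real.pi) * ‖∫ t : ℝ, F (1 + t * I) *
        (((x : ℂ) ^ (1 + t * I) - (y : ℂ) ^ (1 + t * I)) / ((1 + t * I) * (2 + t * I)))‖ := by
        congr 3
        ext t
        ring
    _ ≤ 1 / (2 * Real.pi) * (16 * (K * Real.log q) *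
        (x ^ (-(1 / 4) : ℝ) + y ^ (-(1 / 4) : ℝ)) * J) :=
        mul_le_mul_of_nonneg_left hX.2 (by positivity [Real.pi_pos])
    _ = _ := by ring

open ArithmeticFunction in
theorem norm_sum_twistedVonMangoldt_sub_rieszMean_le {q : ℕ} (χ : DirichletCharacter ℂ q)
    {σ x : ℝ} (hσ : 1 ≤ σ) (hx : 1 ≤ x) :
    ‖∑ n ∈ Finset.Icc 1 ⌊x⌋₊, twistedVonMangoldt χ σ n - rieszMean (twistedVonMangoldt χ σ) x‖
      ≤ Real.log 4 + 4 := by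
  have hx0 : 0 < x := by linarith
  rw [rieszMean, ← Finset.sum_sub_distrib]
  calc _ ≤ ∑ n ∈ Finset.Icc 1 ⌊x⌋₊, vonMangoldt n / x := by
        refine norm_sum_le_of_le _ fun n hn => ?_
        have hn0 : (0 : ℝ) < n := by exact_mod_cast (Finset.mem_Icc.mp hn).1
        have e : twistedVonMangoldt χ σ n - twistedVonMangoldt χ σ n * ((1 - n / x : ℝ) : ℂ)
            = twistedVonMangoldt χ σ n * ((n / x : ℝ) : ℂ) := by
          push_cast
          ring
        rw [e, norm_mul, Complex.norm_real, Real.norm_eq_abs, abs_of_pos (div_pos hn0 hx0)]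
        refine (mul_le_mul_of_nonneg_right (norm_twistedVonMangoldt_le χ hσ n)
          (by positivity)).trans (le_of_eq ?_)
        field_simp
    _ = Chebyshev.psi x / x := by
        rw [← Finset.sum_div, Chebyshev.psi]
        congr 2
    _ ≤ _ := (div_le_iff₀ hx0).mpr (Chebyshev.psi_le_const_mul_self hx0.le)

open ArithmeticFunction in
theorem norm_rieszMean_twistedVonMangoldt_le {q : ℕ} (χ : DirichletCharacter ℂ q) {σ x : ℝ}
    (hσ : 1 ≤ σ) (hx : 0 < x) :
    ‖rieszMean (twistedVonMangoldt χ σ) x‖ ≤ ∑ n ∈ Finset.Icc 1 ⌊x⌋₊, vonMangoldt n / n := by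
  refine norm_sum_le_of_le _ fun n hn => ?_
  have hnx : (n : ℝ) ≤ x := (Nat.le_floor_iff hx.le).mp (Finset.mem_Icc.mp hn).2
  have h1 : (n : ℝ) / x ≤ 1 := (div_le_one hx).mpr hnx
  have h2 : 0 ≤ (n : ℝ) / x := by positivity
  rw [norm_mul, Complex.norm_real, Real.norm_eq_abs, abs_of_nonneg (by linarith)]
  exact (mul_le_of_le_one_right (norm_nonneg _) (by linarith)).trans
    (norm_twistedVonMangoldt_le χ hσ n)

open ArithmeticFunction in
/-- Uniform in the length of the sum: beyond `n = (log q) ^ 4` the Riesz means change by `O(1)`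
only, and up to there Mertens' theorem bounds the sum trivially. -/
theorem exists_norm_sum_twistedVonMangoldt_le :
    ∃ C : ℝ, ∀ (q : ℕ) [NeZero q] (χ : DirichletCharacter ℂ q), 3 ≤ q → χ ≠ 1 → GRHFor χ →
      ∀ σ x : ℝ, 1 ≤ σ → 1 ≤ x →
        ‖∑ n ∈ Finset.Icc 1 ⌊x⌋₊, twistedVonMangoldt χ σ n‖
          ≤ C + 4 * Real.log (Real.log q) := by
  obtain ⟨K, hK0, hK⟩ := exists_norm_rieszMean_sub_rieszMean_le
  obtain ⟨M, hM⟩ := exists_abs_sum_vonMangoldt_div_sub_log_le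
  refine ⟨Real.log 4 + 4 + 2 * K + M, fun q _ χ hq hχ hG σ x hσ hx => ?_⟩
  have hlog4 : 0 ≤ Real.log 4 := Real.log_nonneg (by norm_num)
  have hlog : 1 ≤ Real.log q := one_le_log_natCast hq
  set y : ℝ := Real.log q ^ 4 with hy
  have hy1 : 1 ≤ y := one_le_pow₀ hlog
  have hlogy : Real.log y = 4 * Real.log (Real.log q) := by
    rw [hy, Real.log_pow]
    norm_num
  rcases le_total x y with hxy | hxy
  · have h1 := (abs_le.mp (hM x hx)).2
    have h2 := Real.log_le_log (by linarith) hxy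
    have h3 : ‖∑ n ∈ Finset.Icc 1 ⌊x⌋₊, twistedVonMangoldt χ σ n‖
        ≤ ∑ n ∈ Finset.Icc 1 ⌊x⌋₊, vonMangoldt n / n :=
      norm_sum_le_of_le _ fun n _ => norm_twistedVonMangoldt_le χ hσ n
    linarith
  · have h1 := norm_sum_twistedVonMangoldt_sub_rieszMean_le χ hσ hx
    have h2 := hK q χ hq hχ hG σ x y hσ hx hy1
    have h3 := norm_rieszMean_twistedVonMangoldt_le χ hσ (x := y) (by linarith)
    have h4 := (abs_le.mp (hM y hy1)).2
    -- the exponent `4` in `y` makes `log q * y ^ (-1/4) = 1`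
    have hyq : y ^ (-(1 / 4) : ℝ) = (Real.log q)⁻¹ := by
      rw [hy, ← Real.rpow_natCast, ← Real.rpow_mul (by linarith), ← Real.rpow_neg_one]
      norm_num
    have hxq : x ^ (-(1 / 4) : ℝ) ≤ (Real.log q)⁻¹ := by
      rw [← hyq]
      exact Real.rpow_le_rpow_of_nonpos (by linarith) hxy (by norm_num)
    have h5 : K * Real.log q * (x ^ (-(1 / 4) : ℝ) + y ^ (-(1 / 4) : ℝ)) ≤ 2 * K := by
      calc _ ≤ K * Real.log q * ((Real.log q)⁻¹ + (Real.log q)⁻¹) :=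
            mul_le_mul_of_nonneg_left (by linarith) (by positivity)
        _ = 2 * K := by
            have : Real.log q ≠ 0 := by linarith
            field_simp
            ring
    set T := ∑ n ∈ Finset.Icc 1 ⌊x⌋₊, twistedVonMangoldt χ σ n
    set R := rieszMean (twistedVonMangoldt χ σ)
    calc ‖T‖ = ‖(T - R x) + (R x - R y) + R y‖ := by ring_nf
      _ ≤ ‖T - R x‖ + ‖R x - R y‖ + ‖R y‖ := norm_add₃_le
      _ ≤ _ := by linarith

theorem norm_mul_div_sub_sub_mul_div_le {z : ℂ} (hz : ‖z‖ ≤ 1) {p P l : ℝ} (hp : 2 ≤ p)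
    (hP : p ≤ P) (hl : 0 ≤ l) :
    ‖z * (l : ℂ) / ((P : ℂ) - z) - z * (l : ℂ) / (P : ℂ)‖ ≤ 2 * (l / p ^ 2) := by
  have hPz : P - 1 ≤ ‖(P : ℂ) - z‖ := by
    have h := norm_sub_norm_le (P : ℂ) z
    rw [Complex.norm_real, Real.norm_eq_abs, abs_of_pos (by linarith)] at h
    linarith
  have hP0 : (P : ℂ) ≠ 0 := by
    have : P ≠ 0 := by linarith
    exact_mod_cast this
  have hPz0 : (P : ℂ) - z ≠ 0 := norm_pos_iff.mp (by linarith)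
  have e : z * (l : ℂ) / ((P : ℂ) - z) - z * (l : ℂ) / (P : ℂ)
      = z * z * l / ((P : ℂ) * ((P : ℂ) - z)) := by
    field_simp
    ring
  rw [e, norm_div, norm_mul, norm_mul, norm_mul, Complex.norm_real, Complex.norm_real,
    Real.norm_eq_abs, Real.norm_eq_abs, abs_of_nonneg hl, abs_of_pos (by linarith : 0 < P)]
  have hnum : ‖z‖ * ‖z‖ * l ≤ l :=
    mul_le_of_le_one_left hl (mul_le_one₀ hz (norm_nonneg _) hz)
  have hden : p ^ 2 / 2 ≤ P * ‖(P : ℂ) - z‖ := by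
    calc p ^ 2 / 2 ≤ p * (p - 1) := by nlinarith
      _ ≤ P * ‖(P : ℂ) - z‖ := mul_le_mul hP (by linarith) (by linarith) (by linarith)
  calc ‖z‖ * ‖z‖ * l / (P * ‖(P : ℂ) - z‖) ≤ l / (p ^ 2 / 2) :=
        div_le_div₀ hl hnum (by positivity) hden
    _ = _ := by field_simp

open ArithmeticFunction in
/-- Prime powers contribute `O(1)`, both in the geometric series hidden in `primeSum` and in the
sums over all `n`. -/
theorem exists_norm_primeSum_sub_le :
    ∃ C : ℝ, ∀ (q : ℕ) (χ : DirichletCharacter ℂ q) (x σ : ℝ), 1 ≤ σ →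
      ‖primeSum χ x σ - (((∑ n ∈ Finset.Icc 1 ⌊x⌋₊, vonMangoldt n * (n : ℝ) ^ (-σ) : ℝ) : ℂ)
        + ∑ n ∈ Finset.Icc 1 ⌊x⌋₊, twistedVonMangoldt χ σ n)‖ ≤ C := by
  obtain ⟨M, hM⟩ := exists_sum_vonMangoldt_div_not_prime_le
  have hsum : Summable fun n : ℕ => vonMangoldt n / (n : ℝ) ^ 2 := by
    have h := (LSeriesSummable_vonMangoldt (s := 2) (by simp)).norm
    refine h.congr fun n => ?_
    rw [LSeries.norm_term_eq]
    split_ifs with hn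
    · simp [hn]
    · simp [abs_of_nonneg (vonMangoldt_nonneg (n := n))]
  refine ⟨4 * ∑' n : ℕ, vonMangoldt n / (n : ℝ) ^ 2 + 2 * M, fun q χ x σ hσ => ?_⟩
  set s := Finset.Icc 1 ⌊x⌋₊
  set b : ℕ → ℂ := fun n =>
    ((vonMangoldt n * (n : ℝ) ^ (-σ) : ℝ) : ℂ) + twistedVonMangoldt χ σ n with hb
  have hall : ((∑ n ∈ s, vonMangoldt n * (n : ℝ) ^ (-σ) : ℝ) : ℂ)
      + ∑ n ∈ s, twistedVonMangoldt χ σ n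
      = ∑ n ∈ s with n.Prime, b n + ∑ n ∈ s with ¬ n.Prime, b n := by
    rw [Finset.sum_filter_add_sum_filter_not, hb, Finset.sum_add_distrib, Complex.ofReal_sum]
  have hnp : ‖∑ n ∈ s with ¬ n.Prime, b n‖ ≤ 2 * M := by
    calc _ ≤ ∑ n ∈ s with ¬ n.Prime, 2 * (vonMangoldt n / n) := by
          refine norm_sum_le_of_le _ fun n _ => (norm_add_le _ _).trans ?_
          rw [Complex.norm_real, Real.norm_eq_abs, abs_of_nonneg (vonMangoldt_mul_rpow_nonneg σ n)]
          have h1 := vonMangoldt_mul_rpow_le_div hσ n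
          have h2 := norm_twistedVonMangoldt_le χ hσ n
          linarith
      _ ≤ _ := by
          rw [← Finset.mul_sum]
          exact mul_le_mul_of_nonneg_left (hM s) zero_le_two
  have hp : ‖primeSum χ x σ - ∑ n ∈ s with n.Prime, b n‖
      ≤ 4 * ∑' n : ℕ, vonMangoldt n / (n : ℝ) ^ 2 := by
    rw [primeSum, ← Finset.sum_sub_distrib]
    calc _ ≤ ∑ p ∈ s with p.Prime, 4 * (vonMangoldt p / (p : ℝ) ^ 2) := by
          refine norm_sum_le_of_le _ fun p hp => ?_
          have hpp : p.Prime := (Finset.mem_filter.mp hp).2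
          have hp2 : (2 : ℝ) ≤ p := by exact_mod_cast hpp.two_le
          have hP : (p : ℝ) ≤ (p : ℝ) ^ σ := by
            simpa using Real.rpow_le_rpow_of_exponent_le (by linarith : (1 : ℝ) ≤ p) hσ
          have hl : 0 ≤ Real.log p := Real.log_nonneg (by linarith)
          have h1 := norm_mul_div_sub_sub_mul_div_le (z := 1) (by simp) hp2 hP hl
          have h2 := norm_mul_div_sub_sub_mul_div_le (χ.norm_le_one p) hp2 hP hl
          have hbp : b p = 1 * (Real.log p : ℂ) / (((p : ℝ) ^ σ : ℝ) : ℂ)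
              + χ p * (Real.log p : ℂ) / (((p : ℝ) ^ σ : ℝ) : ℂ) := by
            simp only [hb, twistedVonMangoldt, vonMangoldt_apply_prime hpp,
              Real.rpow_neg (Nat.cast_nonneg p), Complex.ofReal_mul, Complex.ofReal_inv]
            ring
          rw [hbp, vonMangoldt_apply_prime hpp]
          rw [one_mul] at h1 ⊢
          rw [add_sub_add_comm]
          refine (norm_add_le _ _).trans ?_
          linarith
      _ ≤ _ := by
          rw [← Finset.mul_sum]
          refine mul_le_mul_of_nonneg_left (hsum.sum_le_tsum _ fun n _ => ?_) (by norm_num)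
          exact div_nonneg vonMangoldt_nonneg (by positivity)
  rw [hall, ← sub_sub]
  exact (norm_sub_le _ _).trans (by linarith)

theorem three_le_of_dirichletCharacter_ne_one {q : ℕ} [NeZero q] {χ : DirichletCharacter ℂ q}
    (hχ : χ ≠ 1) : 3 ≤ q := by
  by_contra! h
  have hq : q ≠ 0 := NeZero.ne q
  have : Subsingleton (ZMod q)ˣ := by
    interval_cases q
    · exact absurd rfl hq
    · infer_instance
    · exact ⟨by decide⟩
  exact hχ (MulChar.ext fun u => by simp [Subsingleton.elim u 1])

open ArithmeticFunction in
theorem lemma2p3 (θ lam : ℝ) (hθ : 0 < θ) (hlam : 0 < lam) :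
    ∃ C : ℝ, ∀ (q : ℕ) [NeZero q] (χ : DirichletCharacter ℂ q),
      χ.IsPrimitive → χ.IsQuadratic → χ ≠ 1 → GRHFor χ →
        ‖primeSum χ ((q : ℝ) ^ θ) (1 + lam / Real.log q)
            - (((1 - Real.exp (-(lam * θ))) / lam * Real.log q : ℝ) : ℂ)‖
          ≤ C * Real.log (Real.log q) := by
  obtain ⟨C₁, hC₁⟩ := exists_norm_primeSum_sub_le
  obtain ⟨C₂, hC₂⟩ := exists_abs_sum_vonMangoldt_div_mul_rpow_sub_le
  obtain ⟨C₃, hC₃⟩ := exists_norm_sum_twistedVonMangoldt_le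
  -- an additive constant is absorbed into `log log q`, which is at least `log log 3 > 0`
  refine ⟨|C₁ + C₂ + C₃| / Real.log (Real.log 3) + 4, fun q _ χ _ _ hχ hG => ?_⟩
  have hq : 3 ≤ q := three_le_of_dirichletCharacter_ne_one hχ
  have hq3 : (3 : ℝ) ≤ q := by exact_mod_cast hq
  have hlog : 1 ≤ Real.log q := one_le_log_natCast hq
  have hlog3 : 1 < Real.log 3 := by
    rw [Real.lt_log_iff_exp_lt (by norm_num)]
    have := Real.exp_one_lt_d9
    linarith
  have hLL3 : 0 < Real.log (Real.log 3) := Real.log_pos hlog3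
  have hLL : Real.log (Real.log 3) ≤ Real.log (Real.log q) :=
    Real.log_le_log (by linarith) (Real.log_le_log (by norm_num) hq3)
  set δ := lam / Real.log q with hδ
  have hδ0 : 0 < δ := by positivity
  set N := (q : ℝ) ^ θ with hN
  have hN1 : 1 ≤ N := Real.one_le_rpow (by linarith) hθ.le
  have h1 := hC₁ q χ N (1 + δ) (by linarith)
  have h2 := hC₂ δ hδ0 N hN1
  have h3 := hC₃ q χ hq hχ hG (1 + δ) N (by linarith) hN1
  have hNδ : N ^ (-δ) = Real.exp (-(lam * θ)) := by
    rw [hN, ← Real.rpow_mul (by linarith), Real.rpow_def_of_pos (by linarith), hδ]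
    congr 1
    field_simp
  have hmain : (1 - N ^ (-δ)) / δ = (1 - Real.exp (-(lam * θ))) / lam * Real.log q := by
    rw [hNδ, hδ]
    field_simp
  have hsum : ∑ n ∈ Finset.Icc 1 ⌊N⌋₊, vonMangoldt n / n * (n : ℝ) ^ (-δ)
      = ∑ n ∈ Finset.Icc 1 ⌊N⌋₊, vonMangoldt n * (n : ℝ) ^ (-(1 + δ)) := by
    refine Finset.sum_congr rfl fun n hn => ?_
    have hn0 : (0 : ℝ) < n := by exact_mod_cast (Finset.mem_Icc.mp hn).1
    rw [neg_add, Real.rpow_add hn0, Real.rpow_neg_one]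
    ring
  rw [hmain, hsum] at h2
  set A := primeSum χ N (1 + δ)
  set B := ∑ n ∈ Finset.Icc 1 ⌊N⌋₊, vonMangoldt n * (n : ℝ) ^ (-(1 + δ))
  set T := ∑ n ∈ Finset.Icc 1 ⌊N⌋₊, twistedVonMangoldt χ (1 + δ) n
  set m := (1 - Real.exp (-(lam * θ))) / lam * Real.log q
  have h2' : ‖((B - m : ℝ) : ℂ)‖ ≤ C₂ := by
    rwa [Complex.norm_real, Real.norm_eq_abs]
  have hconst : |C₁ + C₂ + C₃| ≤
      |C₁ + C₂ + C₃| / Real.log (Real.log 3) * Real.log (Real.log q) := by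
    rw [div_mul_eq_mul_div, le_div_iff₀ hLL3]
    exact mul_le_mul_of_nonneg_left hLL (abs_nonneg _)
  calc ‖A - (m : ℂ)‖ = ‖(A - ((B : ℂ) + T)) + ((B - m : ℝ) : ℂ) + T‖ := by
        push_cast
        ring_nf
    _ ≤ ‖A - ((B : ℂ) + T)‖ + ‖((B - m : ℝ) : ℂ)‖ + ‖T‖ := norm_add₃_le
    _ ≤ |C₁ + C₂ + C₃| + 4 * Real.log (Real.log q) := by
        have := le_abs_self (C₁ + C₂ + C₃)
        linarith
    _ ≤ _ := by
        rw [add_mul]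
        linarith
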